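/- **Setting.** Let $L\ge 2$ and $K$ be integers, $\mathcal Y=\{1,\dots,L\}$ the set of labels, and $\pi(y)>0$ ($y\in\mathcal Y$) a prior with $\sum_y\pi(y)=1$. For $m=1,\dots,K$ let $\mathcal X_m$ be a finite alphabet, $p_m(\cdot\mid y)$, $y\in\mathcal Y$, strictly positive probability distributions on $\mathcal X_m$, and $c_m>0$ the cost of one query to model $m$. A query plan is a vector $r\in\mathbb Z_{\ge0}^K$; its cost is $C(r)=\sum_m c_m r_m$. Conditionally on the true label $Y=y$, the plan produces independent responses $X(r)=(X_{m,t})_{1\le m\le K,\,1\le t\le r_m}$ with $X_{m,t}\sim p_m(\cdot\mid y)$. For every plan $r$ let $\widehat Y_r$ be a MAP estimator, that is, $\widehat Y_r(x)\in\arg\max_{y}\,\pi(y)\prod_{m}\prod_{t\le r_m}p_m(x_{m,t}\mid y)$ for every data set $x$, where ties are resolved by a strict preference order on the labels that does not depend on the data (it may depend on $r$). Put $P_e(y;r)=\Pr(\widehat Y_r(X(r))\ne y\mid Y=y)$ and $$\overline P_e(y;r)=\sum_{y'\ne y}\ \min_{s\in[0,1]}\Bigl(\frac{\pi(y')}{\pi(y)}\Bigr)^{s}\prod_{m=1}^K\Bigl(\sum_{x\in\mathcal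 X_m}p_m(x\mid y)^{1-s}p_m(x\mid y')^{s}\Bigr)^{r_m}.$$ For $\alpha=(\alpha_y)_{y}\in(0,1)^L$ let $\alpha_{\min}=\min_y\alpha_y$ and $$\mathrm{OPT}(\alpha)=\min\{C(r): P_e(y;r)\le\alpha_y\ \forall y\},\qquad \overline{\mathrm{OPT}}(\alpha)=\min\{C(r): \overline P_e(y;r)\le\alpha_y\ \forall y\},\qquad \min\emptyset:=+\infty .$$ **Theorem (optimization-level tightness).** Assume that for all $y\ne y'$ there is a model $m$ with $p_m(\cdot\mid y)\ne p_m(\cdot\mid y')$, and that there is $B<\infty$ with $\bigl|\log\frac{p_m(x\mid y')}{p_m(x\mid y)}\bigr|\le B$ for all $m$, all $y\neq y'$ and all $x\in\mathcal X_m$. Then there are constants $A>0$ and $\varepsilon\in(0,1)$, which depend on the labels, prior, response distributions and costs, but not on $\alpha$ or on how ties are broken, such that for every $\alpha\in(0,1)^L$ with $\alpha_{\min}<\varepsilon$ and $\mathrm{OPT}(\alpha)<\infty$, $$1\ \le\ \frac{\overline{\mathrm{OPT}}(\alpha)}{\mathrm{OPT}(\alpha)}\ \le\ 1+A\,\frac{\log\log(1/\alpha_{\min})}{\log(1/\alpha_{\min})}.$$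 In particular, the ratio tends to $1$ as $\alpha_{\min}\downarrow0$ (along $\alpha\in(0,1)^L$ with $\mathrm{OPT}(\alpha)<\infty$). -/

import Mathlib

open Set Filter Topology
open scoped ENNReal

/-- A finite classification task with `L` labels and `K` queryable models; a query to model `m`
returns a symbol of the finite alphabet `X m`. -/
structure QueryModel (L K : ℕ) (X : Fin K → Type*) [∀ m, Fintype (X m)] where
  /-- The prior probability of each label. -/
  prior : Fin L → ℝ
  /-- `p m y x` is the probability that a query to model `m` returns `x` when the label is `y`. -/
  p : (m : Fin K) → Fin L → X m → ℝ
  /-- The cost of one query to each model. -/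
  cost : Fin K → ℝ
  prior_pos : ∀ y, 0 < prior y
  prior_sum : ∑ y, prior y = 1
  p_pos : ∀ m y x, 0 < p m y x
  p_sum : ∀ m y, ∑ x, p m y x = 1
  cost_pos : ∀ m, 0 < cost m

namespace QueryModel

/-- The data sets produced by the query plan `r`: the responses `x m t`, `t < r m`. -/
abbrev Obs {K : ℕ} (X : Fin K → Type*) (r : Fin K → ℕ) : Type _ :=
  (m : Fin K) → Fin (r m) → X m

noncomputable section

variable {L K : ℕ} {X : Fin K → Type*} [∀ m, Fintype (X m)] (Q : QueryModel L K X)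

/-- Every two distinct labels are told apart by at least one model. -/
def Distinguishable : Prop :=
  ∀ y y' : Fin L, y ≠ y' → ∃ m, Q.p m y ≠ Q.p m y'

/-- All log-likelihood ratios are at most `B` in absolute value. -/
def BoundedLLR (B : ℝ) : Prop :=
  ∀ (m : Fin K) (y y' : Fin L), y ≠ y' → ∀ x : X m,
    |Real.log (Q.p m y' x / Q.p m y x)| ≤ B

/-- The total cost of a query plan. -/
def planCost (r : Fin K → ℕ) : ℝ := ∑ m, Q.cost m * r m

/-- The probability of the data set `x` given that the label is `y`. -/
def likelihood (r : Fin K → ℕ) (y : Fin L) (x : Obs X r) : ℝ :=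
  ∏ m, ∏ t, Q.p m y (x m t)

/-- The unnormalized posterior weight of the label `y`. -/
def weight (r : Fin K → ℕ) (y : Fin L) (x : Obs X r) : ℝ :=
  Q.prior y * Q.likelihood r y x

/-- `Yhat` is a maximum-a-posteriori estimator: for each plan it always selects a label of maximal
posterior weight, and it resolves ties by a strict preference order on the labels (the label of
smallest rank wins), which may depend on the plan but not on the data. -/
def IsMAP (Yhat : (r : Fin K → ℕ) → Obs X r → Fin L) : Prop :=
  ∀ r : Fin K → ℕ,
    (∀ x y, Q.weight r y x ≤ Q.weight r (Yhat r x) x) ∧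
    ∃ rank : Fin L → ℕ, Function.Injective rank ∧
      ∀ x y, Q.weight r y x = Q.weight r (Yhat r x) x → rank (Yhat r x) ≤ rank y

open Classical in
/-- The statewise error probability `Pr (Yhat ≠ y | Y = y)` under the plan `r`. -/
def errorProb (Yhat : (r : Fin K → ℕ) → Obs X r → Fin L) (y : Fin L) (r : Fin K → ℕ) : ℝ :=
  ∑ x : Obs X r, if Yhat r x ≠ y then Q.likelihood r y x else 0

/-- The Chernoff affinity factor of model `m` for the pair `(y, y')` at tilt `s`. -/
def affinity (m : Fin K) (y y' : Fin L) (s : ℝ) : ℝ :=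
  ∑ x, Q.p m y x ^ (1 - s) * Q.p m y' x ^ s

/-- The pairwise Chernoff bound, minimized over the tilt `s ∈ [0, 1]` (the objective is positive
and continuous on `[0, 1]`, so the infimum is a minimum). -/
def pairBound (y y' : Fin L) (r : Fin K → ℕ) : ℝ :=
  ⨅ s : Icc (0 : ℝ) 1,
    (Q.prior y' / Q.prior y) ^ (s : ℝ) * ∏ m, Q.affinity m y y' s ^ r m

/-- The surrogate statewise error probability. -/
def surrogateError (y : Fin L) (r : Fin K → ℕ) : ℝ :=
  ∑ y' ∈ Finset.univ.erase y, Q.pairBound y y' r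

/-- The plans that meet all error tolerances. -/
def feasible (Yhat : (r : Fin K → ℕ) → Obs X r → Fin L) (α : Fin L → ℝ) : Set (Fin K → ℕ) :=
  {r | ∀ y, Q.errorProb Yhat y r ≤ α y}

/-- The plans whose surrogate errors meet all error tolerances. -/
def surrogateFeasible (α : Fin L → ℝ) : Set (Fin K → ℕ) :=
  {r | ∀ y, Q.surrogateError y r ≤ α y}

/-- The least cost of a feasible plan, `∞` if there is none. -/
def opt (Yhat : (r : Fin K → ℕ) → Obs X r → Fin L) (α : Fin L → ℝ) : ℝ≥0∞ :=
  ⨅ r ∈ Q.feasible Yhat α, ENNReal.ofReal (Q.planCost r)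

/-- The least cost of a surrogate-feasible plan, `∞` if there is none. -/
def surrogateOpt (α : Fin L → ℝ) : ℝ≥0∞ :=
  ⨅ r ∈ Q.surrogateFeasible α, ENNReal.ofReal (Q.planCost r)

/-- The smallest error tolerance. -/
def tolMin (α : Fin L → ℝ) : ℝ := ⨅ y, α y

end

end QueryModel

/-! The lower bound is the Chernoff union bound: by `errorProb_le_surrogateError`,
surrogate-feasible plans are feasible. For the upper bound, a feasible plan with `n` queries becomes
surrogate-feasible after `O(1 + log n)` extra queries to every model
(`exists_add_mem_surrogateFeasible`). Feasibility forces `n` to be at least of order `M = log (1 /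
tolMin α)` (`log_le_of_mem_feasible`), and the cost is at least proportional to `n`, so the relative
extra cost is `O(log n / n)`, hence `O(log M / M)`.

The heart is the pairwise estimate `exists_pairBound_add_le`. If many queries go to models
separating `y` from `y'`, some tilt `s`, bounded away from `0` and `1`, gives the posterior log-odds
a fixed positive mean. A most likely type class of the tilted law then consists of data sets not
decided for `y` and has at least inverse polynomial mass, so changing measure shows that the
Chernoff objective at `s` exceeds the error probability by at most a polynomial factor. If few
queries separate the labels, copying their responses from one data set decided for `y'` already
gives an error event of probability bounded below. In both cases each extra round of queries gains a
fixed factor `exp (-γ)`, so logarithmically many rounds absorb the loss. -/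

/-! ### Type classes and their most likely member. -/

section TypeClass

variable {X : Type*} [DecidableEq X] {n : ℕ}

/-- The number of occurrences of the symbol `a` in the sequence `x`. -/
def symbolCount (x : Fin n → X) (a : X) : ℕ := (Finset.univ.filter fun t => x t = a).card

lemma symbolCount_le (x : Fin n → X) (a : X) : symbolCount x a ≤ n := by
  simpa [symbolCount] using Finset.card_filter_le (Finset.univ : Finset (Fin n)) (fun t => x t = a)

/-- Replacing one `a` by `b` lowers the count of `a` and raises that of `b`. -/
lemma symbolCount_update {a b : X} (hab : a ≠ b) (x : Fin n → X) (t : Fin n) (ht : x t = a)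
    (c : X) : symbolCount (Function.update x t b) c + (if c = a then 1 else 0) =
      symbolCount x c + (if c = b then 1 else 0) := by
  unfold symbolCount
  by_cases hca : c = a
  · subst hca
    have : (Finset.univ.filter fun u => x u = c) =
        insert t (Finset.univ.filter fun u => Function.update x t b u = c) := by
      ext u
      by_cases hu : u = t
      · subst hu; simp [ht]
      · simp [hu]
    rw [this, Finset.card_insert_of_notMem (by simp [hab.symm])]
    simp [hab]
  · by_cases hcb : c = b
    · subst hcb
      have : (Finset.univ.filter fun u => Function.update x t c u = c) =
          insert t (Finset.univ.filter fun u => x u = c) := by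
        ext u
        by_cases hu : u = t
        · subst hu; simp
        · simp [hu]
      rw [this, Finset.card_insert_of_notMem (by simp [ht, hab])]
      simp [hca]
    · have : (Finset.univ.filter fun u => Function.update x t b u = c) =
          (Finset.univ.filter fun u => x u = c) := by
        ext u
        by_cases hu : u = t
        · subst hu; simp [ht, Ne.symm hca, Ne.symm hcb]
        · simp [hu]
      simp [this, hca, hcb]

variable [Fintype X]

lemma sum_symbolCount_mul (x : Fin n → X) (f : X → ℝ) :
    ∑ a, (symbolCount x a : ℝ) * f a = ∑ t, f (x t) := by
  rw [← Finset.sum_fiberwise (s := Finset.univ) (g := x) (f := fun t => f (x t))]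
  refine Finset.sum_congr rfl fun a _ => ?_
  rw [Finset.sum_congr rfl (g := fun _ => f a) (fun t ht => by rw [(Finset.mem_filter.1 ht).2])]
  simp [symbolCount]

lemma sum_symbolCount (x : Fin n → X) : ∑ a, (symbolCount x a : ℝ) = n := by
  simpa using sum_symbolCount_mul x (fun _ => 1)

/-- The product-measure mass of the sequences with symbol counts `N`. -/
noncomputable def typeMass (n : ℕ) (q : X → ℝ) (N : X → ℕ) : ℝ :=
  ∑ x : Fin n → X with symbolCount x = N, ∏ t, q (x t)

/-- Double counting of sequences with a marked position: overwriting a marked `a` by `b` is a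
bijection between the two classes of marked sequences, and it multiplies the mass by `q b / q a`. -/
lemma typeMass_swap (q : X → ℝ) {a b : X} (hab : a ≠ b) {N N' : X → ℕ}
    (hN : ∀ c, N' c + (if c = a then 1 else 0) = N c + (if c = b then 1 else 0)) :
    N a * q b * typeMass n q N = (N b + 1) * q a * typeMass n q N' := by
  have hNb : N' b = N b + 1 := by simpa [hab.symm] using hN b
  have h1 : ∀ (N : X → ℕ) (a b : X), N a * q b * typeMass n q N =
      ∑ z : (Fin n → X) × Fin n with symbolCount z.1 = N ∧ z.1 z.2 = a,
        q b * ∏ t, q (z.1 t) := by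
    intro N a b
    rw [typeMass, Finset.mul_sum, Finset.sum_filter, Finset.sum_filter, Fintype.sum_prod_type]
    refine Finset.sum_congr rfl fun x _ => ?_
    by_cases hx : symbolCount x = N
    · simp only [hx, if_true, true_and]
      rw [← Finset.sum_filter, Finset.sum_const, nsmul_eq_mul, ← hx]
      simp only [symbolCount]; ring
    · simp [hx]
  have h2 := h1 N' b a
  rw [hNb] at h2; push_cast at h2
  rw [h1 N a b, h2]
  refine Finset.sum_bij' (fun z _ => (Function.update z.1 z.2 b, z.2))
    (fun z _ => (Function.update z.1 z.2 a, z.2)) ?_ ?_ ?_ ?_ ?_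
  · rintro ⟨x, t⟩ hz
    simp only [Finset.mem_filter, Finset.mem_univ, true_and] at hz ⊢
    refine ⟨?_, by simp⟩
    funext c
    have := symbolCount_update hab x t hz.2 c
    have := hN c
    rw [hz.1] at *
    omega
  · rintro ⟨x, t⟩ hz
    simp only [Finset.mem_filter, Finset.mem_univ, true_and] at hz ⊢
    refine ⟨?_, by simp⟩
    funext c
    have := symbolCount_update hab.symm x t hz.2 c
    have := hN c
    rw [hz.1] at *
    omega
  · rintro ⟨x, t⟩ hz
    simp only [Finset.mem_filter, Finset.mem_univ, true_and] at hz
    simp [← hz.2]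
  · rintro ⟨x, t⟩ hz
    simp only [Finset.mem_filter, Finset.mem_univ, true_and] at hz
    simp [← hz.2]
  · rintro ⟨x, t⟩ hz
    simp only [Finset.mem_filter, Finset.mem_univ, true_and] at hz
    rw [← Finset.mul_prod_erase _ _ (Finset.mem_univ t),
      ← Finset.mul_prod_erase _ (fun u => q (Function.update x t b u)) (Finset.mem_univ t)]
    have : ∀ u ∈ Finset.univ.erase t, q (Function.update x t b u) = q (x u) := by
      intro u hu
      rw [Function.update_of_ne (Finset.ne_of_mem_erase hu)]
    rw [Finset.prod_congr rfl this]
    simp only [Function.update_self, hz.2]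
    ring

/-- A most likely type class carries polynomial mass, and its empirical averages are within
`O(1 / n)` of the means. -/
lemma exists_typical_class (q : X → ℝ) (hq : ∀ a, 0 < q a) (hq1 : ∑ a, q a = 1) (n : ℕ) :
    ∃ T : Finset (Fin n → X), (((n : ℝ) + 1) ^ Fintype.card X)⁻¹ ≤ ∑ x ∈ T, ∏ t, q (x t) ∧
      ∀ (f : X → ℝ) (B : ℝ), (∀ a, |f a| ≤ B) → ∀ x ∈ T,
        |∑ t, f (x t) - n * ∑ a, q a * f a| ≤ (Fintype.card X : ℝ) ^ 2 * B := by
  have hX : Nonempty X := by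
    by_contra h
    rw [not_nonempty_iff] at h
    simp at hq1
  have hcard : (1 : ℝ) ≤ Fintype.card X := by exact_mod_cast Fintype.card_pos
  have hmass0 : ∀ N, 0 ≤ typeMass n q N := fun N =>
    Finset.sum_nonneg fun x _ => Finset.prod_nonneg fun t _ => (hq _).le
  obtain ⟨N₀, -, hmax⟩ := Finset.exists_max_image (Finset.univ : Finset (X → Fin (n + 1)))
    (fun N => typeMass n q (fun a => (N a : ℕ))) Finset.univ_nonempty
  set N : X → ℕ := fun a => N₀ a with hNdef
  have htot : ∑ M : X → Fin (n + 1), typeMass n q (fun a => (M a : ℕ)) = 1 := by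
    have h1 : ∑ x : Fin n → X, ∏ t, q (x t) = 1 := by
      have := Finset.prod_univ_sum (fun _ : Fin n => (Finset.univ : Finset X)) (fun _ a => q a)
      simpa [hq1] using this.symm
    rw [← h1, ← Finset.sum_fiberwise (s := Finset.univ)
      (g := fun (x : Fin n → X) (a : X) =>
        (⟨symbolCount x a, Nat.lt_succ_of_le (symbolCount_le x a)⟩ : Fin (n + 1)))]
    refine Finset.sum_congr rfl fun M _ => Finset.sum_congr ?_ fun _ _ => rfl
    ext x
    simp [funext_iff, Fin.ext_iff]
  -- Pigeonhole: total mass `1` is shared by at most `(n + 1) ^ |X|` classes.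
  have hN1 : (((n : ℝ) + 1) ^ Fintype.card X)⁻¹ ≤ typeMass n q N := by
    have h := Finset.sum_le_card_nsmul _ _ _ hmax
    rw [htot] at h
    simp only [Finset.card_univ, Fintype.card_fun, Fintype.card_fin, nsmul_eq_mul] at h
    push_cast at h
    rw [inv_le_iff_one_le_mul₀ (by positivity), mul_comm]
    exact h
  have hpos : 0 < typeMass n q N := lt_of_lt_of_le (by positivity) hN1
  have hNmax : ∀ x : Fin n → X, typeMass n q (symbolCount x) ≤ typeMass n q N := fun x =>
    hmax (fun a => ⟨symbolCount x a, Nat.lt_succ_of_le (symbolCount_le x a)⟩) (Finset.mem_univ _)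
  -- Turning one `a` into `b` cannot increase the mass of a maximal class.
  have hswap : ∀ (x : Fin n → X), symbolCount x = N → ∀ a b,
      (N a : ℝ) * q b ≤ (N b + 1) * q a := by
    intro x hx a b
    by_cases hab : a = b
    · subst hab; nlinarith [hq a]
    rcases Nat.eq_zero_or_pos (N a) with h0 | h0
    · have := hq a
      rw [h0]; simp only [Nat.cast_zero, zero_mul]; positivity
    · rw [← hx] at h0
      obtain ⟨t, ht⟩ := Finset.card_pos.1 h0
      have ht' : x t = a := (Finset.mem_filter.1 ht).2
      have h1 := typeMass_swap (n := n) q hab (symbolCount_update hab x t ht')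
      have h2 := hNmax (Function.update x t b)
      rw [hx] at h1
      have h3 : (N a : ℝ) * q b * typeMass n q N ≤ (N b + 1) * q a * typeMass n q N := by
        rw [h1]
        exact mul_le_mul_of_nonneg_left h2 (by have := hq a; positivity)
      exact le_of_mul_le_mul_right h3 hpos
  refine ⟨Finset.univ.filter fun x => symbolCount x = N, hN1, ?_⟩
  intro f B hf x hx
  have hx : symbolCount x = N := (Finset.mem_filter.1 hx).2
  have hs := hswap x hx
  have hsum : ∑ a, (N a : ℝ) = n := by rw [← hx]; exact sum_symbolCount x
  -- The swap inequalities, summed over the other symbol in either role, bound `N a` from both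
  -- sides.
  have hdev : ∀ a, |(N a : ℝ) - n * q a| ≤ Fintype.card X := by
    intro a
    have hqa : q a ≤ 1 := by
      rw [← hq1]; exact Finset.single_le_sum (fun b _ => (hq b).le) (Finset.mem_univ a)
    have h1 : (N a : ℝ) ≤ (n + Fintype.card X) * q a := by
      have := Finset.sum_le_sum fun b (_ : b ∈ Finset.univ) => hs a b
      rw [← Finset.mul_sum, hq1, ← Finset.sum_mul, Finset.sum_add_distrib, hsum] at this
      simpa using this
    have h2 : (n : ℝ) * q a ≤ N a + 1 := by
      have := Finset.sum_le_sum fun b (_ : b ∈ Finset.univ) => hs b a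
      rw [← Finset.mul_sum, hq1, ← Finset.sum_mul, hsum] at this
      simpa using this
    rw [abs_le]
    constructor
    · linarith
    · nlinarith
  rw [← sum_symbolCount_mul, hx, Finset.mul_sum, ← Finset.sum_sub_distrib]
  calc |∑ a, ((N a : ℝ) * f a - n * (q a * f a))|
      ≤ ∑ a, |(N a : ℝ) * f a - n * (q a * f a)| := Finset.abs_sum_le_sum_abs _ _
    _ ≤ ∑ _a : X, (Fintype.card X : ℝ) * B := by
        refine Finset.sum_le_sum fun a _ => ?_
        rw [show (N a : ℝ) * f a - n * (q a * f a) = (N a - n * q a) * f a by ring, abs_mul]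
        exact mul_le_mul (hdev a) (hf a) (abs_nonneg _) (by positivity)
    _ = _ := by simp; ring

end TypeClass

/-! ### Log-likelihood ratios, exponential tilting and the Chernoff bound. -/

namespace QueryModel

noncomputable section

variable {L K : ℕ} {X : Fin K → Type*} [∀ m, Fintype (X m)] (Q : QueryModel L K X)

/-- The log-likelihood ratio of one response of model `m`, for `y'` against `y`. -/
def llr (m : Fin K) (y y' : Fin L) (a : X m) : ℝ := Real.log (Q.p m y' a / Q.p m y a)

/-- The prior log-odds of `y'` against `y`. -/
def logOdds (y y' : Fin L) : ℝ := Real.log (Q.prior y' / Q.prior y)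

/-- The response distribution of model `m` tilted from `y` towards `y'`. -/
def tilt (m : Fin K) (y y' : Fin L) (s : ℝ) (a : X m) : ℝ :=
  Q.p m y a * Real.exp (s * Q.llr m y y' a) / Q.affinity m y y' s

/-- The log-likelihood ratio of a data set, for `y'` against `y`. -/
def logRatio (r : Fin K → ℕ) (y y' : Fin L) (x : Obs X r) : ℝ :=
  ∑ m, ∑ t, Q.llr m y y' (x m t)

/-- The Chernoff objective at tilt `s`. -/
def chernoff (y y' : Fin L) (r : Fin K → ℕ) (s : ℝ) : ℝ :=
  Real.exp (s * Q.logOdds y y') * ∏ m, Q.affinity m y y' s ^ r m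

variable {Q}

lemma p_mul_exp_llr (m : Fin K) (y y' : Fin L) (a : X m) :
    Q.p m y a * Real.exp (Q.llr m y y' a) = Q.p m y' a := by
  have h := Q.p_pos m y a
  have h' := Q.p_pos m y' a
  rw [llr, Real.exp_log (div_pos h' h)]
  field_simp

lemma p_le_one (m : Fin K) (y : Fin L) (a : X m) : Q.p m y a ≤ 1 := by
  rw [← Q.p_sum m y]
  exact Finset.single_le_sum (fun b _ => (Q.p_pos m y b).le) (Finset.mem_univ a)

lemma affinity_eq (m : Fin K) (y y' : Fin L) (s : ℝ) :
    Q.affinity m y y' s = ∑ a, Q.p m y a * Real.exp (s * Q.llr m y y' a) := by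
  refine Finset.sum_congr rfl fun a _ => ?_
  have h := Q.p_pos m y a
  have h' := Q.p_pos m y' a
  rw [llr, Real.log_div h'.ne' h.ne', Real.rpow_def_of_pos h, Real.rpow_def_of_pos h']
  rw [← Real.exp_add, show Real.log (Q.p m y a) * (1 - s) + Real.log (Q.p m y' a) * s =
    Real.log (Q.p m y a) + s * (Real.log (Q.p m y' a) - Real.log (Q.p m y a)) by ring,
    Real.exp_add, Real.exp_log h]

lemma nonempty_alphabet (Q : QueryModel L K X) (y : Fin L) (m : Fin K) : Nonempty (X m) := by
  by_contra h
  rw [not_nonempty_iff] at h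
  simpa using Q.p_sum m y

lemma affinity_pos (m : Fin K) (y y' : Fin L) (s : ℝ) : 0 < Q.affinity m y y' s := by
  have := Q.nonempty_alphabet y m
  rw [affinity_eq]
  exact Finset.sum_pos (fun a _ => mul_pos (Q.p_pos m y a) (Real.exp_pos _)) Finset.univ_nonempty

lemma tilt_pos (m : Fin K) (y y' : Fin L) (s : ℝ) (a : X m) : 0 < Q.tilt m y y' s a :=
  div_pos (mul_pos (Q.p_pos m y a) (Real.exp_pos _)) (affinity_pos m y y' s)

lemma tilt_sum (m : Fin K) (y y' : Fin L) (s : ℝ) : ∑ a, Q.tilt m y y' s a = 1 := by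
  simp only [tilt]
  rw [← Finset.sum_div, ← affinity_eq, div_self (affinity_pos m y y' s).ne']

lemma p_eq_tilt (m : Fin K) (y y' : Fin L) (s : ℝ) (a : X m) :
    Q.p m y a = Q.affinity m y y' s * Q.tilt m y y' s a * Real.exp (-(s * Q.llr m y y' a)) := by
  rw [tilt, Real.exp_neg]
  have := (affinity_pos (Q := Q) m y y' s).ne'
  field_simp

/-- The logarithmic derivative of the affinity is the tilted mean of the log-likelihood ratio, so
stationary points of the log Chernoff objective are the tilts with mean posterior log-odds zero. -/
lemma hasDerivAt_affinity (m : Fin K) (y y' : Fin L) (s : ℝ) :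
    HasDerivAt (Q.affinity m y y')
      (Q.affinity m y y' s * ∑ a, Q.tilt m y y' s a * Q.llr m y y' a) s := by
  have h1 : Q.affinity m y y' = fun s => ∑ a, Q.p m y a * Real.exp (s * Q.llr m y y' a) := by
    funext s; exact affinity_eq m y y' s
  have h2 : Q.affinity m y y' s * ∑ a, Q.tilt m y y' s a * Q.llr m y y' a =
      ∑ a, Q.p m y a * (Real.exp (s * Q.llr m y y' a) * (1 * Q.llr m y y' a)) := by
    rw [Finset.mul_sum]
    refine Finset.sum_congr rfl fun a _ => ?_
    rw [tilt]
    have := (affinity_pos (Q := Q) m y y' s).ne'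
    field_simp
  rw [h2, h1]
  exact HasDerivAt.fun_sum fun a _ =>
    (((hasDerivAt_id s).mul_const _).exp).const_mul _

lemma continuous_affinity (m : Fin K) (y y' : Fin L) : Continuous (Q.affinity m y y') :=
  continuous_iff_continuousAt.2 fun s => (hasDerivAt_affinity m y y' s).continuousAt

lemma affinity_le_one (m : Fin K) (y y' : Fin L) {s : ℝ} (hs0 : 0 ≤ s) (hs1 : s ≤ 1) :
    Q.affinity m y y' s ≤ 1 := by
  calc Q.affinity m y y' s ≤ ∑ a, ((1 - s) * Q.p m y a + s * Q.p m y' a) :=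
        Finset.sum_le_sum fun a _ => Real.geom_mean_le_arith_mean2_weighted (by linarith) hs0
          (Q.p_pos m y a).le (Q.p_pos m y' a).le (by ring)
    _ = 1 := by
        rw [Finset.sum_add_distrib, ← Finset.mul_sum, ← Finset.mul_sum, Q.p_sum, Q.p_sum]; ring

lemma affinity_lt_one {m : Fin K} {y y' : Fin L} (h : Q.p m y ≠ Q.p m y') {s : ℝ} (hs0 : 0 < s)
    (hs1 : s < 1) : Q.affinity m y y' s < 1 := by
  obtain ⟨a, ha⟩ := Function.ne_iff.1 h
  calc Q.affinity m y y' s < ∑ a, ((1 - s) * Q.p m y a + s * Q.p m y' a) :=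
        Finset.sum_lt_sum (fun a _ => Real.geom_mean_le_arith_mean2_weighted (by linarith) hs0.le
          (Q.p_pos m y a).le (Q.p_pos m y' a).le (by ring))
          ⟨a, Finset.mem_univ a, (Real.geom_mean_lt_arith_mean2_weighted_iff_of_pos (by linarith)
            hs0 (Q.p_pos m y a).le (Q.p_pos m y' a).le (by ring)).2 ha⟩
    _ = 1 := by
        rw [Finset.sum_add_distrib, ← Finset.mul_sum, ← Finset.mul_sum, Q.p_sum, Q.p_sum]; ring

lemma affinity_eq_one {m : Fin K} {y y' : Fin L} (h : Q.p m y = Q.p m y') (s : ℝ) :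
    Q.affinity m y y' s = 1 := by
  rw [affinity_eq, ← Q.p_sum m y]
  refine Finset.sum_congr rfl fun a _ => ?_
  simp [llr, ← h, div_self (Q.p_pos m y a).ne']

lemma llr_eq_zero {m : Fin K} {y y' : Fin L} (h : Q.p m y = Q.p m y') (a : X m) :
    Q.llr m y y' a = 0 := by
  simp [llr, ← h, div_self (Q.p_pos m y a).ne']

/-- All response probabilities are at least `exp (-h)`. -/
lemma exists_exp_neg_le (Q : QueryModel L K X) :
    ∃ h : ℝ, 1 ≤ h ∧ ∀ m y a, Real.exp (-h) ≤ Q.p m y a := by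
  obtain ⟨M, hM⟩ := (Set.finite_range
    (fun z : (Σ m, X m) × Fin L => -Real.log (Q.p z.1.1 z.2 z.1.2))).bddAbove
  refine ⟨max 1 M, le_max_left _ _, fun m y a => ?_⟩
  have := hM ⟨(⟨m, a⟩, y), rfl⟩
  rw [← Real.le_log_iff_exp_le (Q.p_pos m y a)]
  have := le_max_right 1 M
  simp only at *
  linarith

lemma abs_llr_le {h : ℝ} (hp : ∀ m y a, Real.exp (-h) ≤ Q.p m y a) (m : Fin K) (y y' : Fin L)
    (a : X m) : |Q.llr m y y' a| ≤ h := by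
  have h1 := Q.p_pos m y a
  have h2 := Q.p_pos m y' a
  have h3 := (Real.le_log_iff_exp_le h1).2 (hp m y a)
  have h4 := (Real.le_log_iff_exp_le h2).2 (hp m y' a)
  have h5 := Real.log_nonpos h1.le (p_le_one m y a)
  have h6 := Real.log_nonpos h2.le (p_le_one m y' a)
  rw [llr, Real.log_div h2.ne' h1.ne', abs_le]
  constructor <;> linarith

/-- This bound and its mirror image at `s = 1` keep the affinity near `1` at the end points, which
forces the minimizing tilt into the interior. -/
lemma exp_neg_mul_le_affinity {h : ℝ} (hp : ∀ m y a, Real.exp (-h) ≤ Q.p m y a) (m : Fin K)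
    (y y' : Fin L) {s : ℝ} (hs0 : 0 ≤ s) : Real.exp (-(h * s)) ≤ Q.affinity m y y' s := by
  rw [affinity_eq]
  calc Real.exp (-(h * s)) = ∑ a, Q.p m y a * Real.exp (-(h * s)) := by
        rw [← Finset.sum_mul, Q.p_sum, one_mul]
    _ ≤ _ := Finset.sum_le_sum fun a _ => by
        refine mul_le_mul_of_nonneg_left (Real.exp_le_exp.2 ?_) (Q.p_pos m y a).le
        have := (abs_le.1 (abs_llr_le hp m y y' a)).1
        nlinarith

lemma exp_neg_mul_one_sub_le_affinity {h : ℝ} (hp : ∀ m y a, Real.exp (-h) ≤ Q.p m y a)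
    (m : Fin K) (y y' : Fin L) {s : ℝ} (hs1 : s ≤ 1) :
    Real.exp (-(h * (1 - s))) ≤ Q.affinity m y y' s := by
  rw [affinity_eq]
  calc Real.exp (-(h * (1 - s))) = ∑ a, Q.p m y' a * Real.exp (-(h * (1 - s))) := by
        rw [← Finset.sum_mul, Q.p_sum, one_mul]
    _ ≤ _ := Finset.sum_le_sum fun a _ => by
        rw [← p_mul_exp_llr m y y' a, mul_assoc, ← Real.exp_add]
        refine mul_le_mul_of_nonneg_left (Real.exp_le_exp.2 ?_) (Q.p_pos m y a).le
        have := (abs_le.1 (abs_llr_le hp m y y' a)).2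
        nlinarith

lemma likelihood_pos (r : Fin K → ℕ) (y : Fin L) (x : Obs X r) : 0 < Q.likelihood r y x :=
  Finset.prod_pos fun m _ => Finset.prod_pos fun _ _ => Q.p_pos m y _

lemma likelihood_mul_exp_logRatio (r : Fin K → ℕ) (y y' : Fin L) (x : Obs X r) :
    Q.likelihood r y x * Real.exp (Q.logRatio r y y' x) = Q.likelihood r y' x := by
  simp only [likelihood, logRatio, Real.exp_sum, ← Finset.prod_mul_distrib, p_mul_exp_llr]

lemma weight_mul_exp (r : Fin K → ℕ) (y y' : Fin L) (x : Obs X r) :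
    Q.weight r y x * Real.exp (Q.logOdds y y' + Q.logRatio r y y' x) = Q.weight r y' x := by
  rw [weight, weight, Real.exp_add, logOdds, Real.exp_log (div_pos (Q.prior_pos _) (Q.prior_pos _)),
    ← likelihood_mul_exp_logRatio r y y' x]
  have := (Q.prior_pos y).ne'
  field_simp

lemma weight_pos (r : Fin K → ℕ) (y : Fin L) (x : Obs X r) : 0 < Q.weight r y x :=
  mul_pos (Q.prior_pos y) (likelihood_pos r y x)

lemma weight_le_iff (r : Fin K → ℕ) (y y' : Fin L) (x : Obs X r) :
    Q.weight r y x ≤ Q.weight r y' x ↔ 0 ≤ Q.logOdds y y' + Q.logRatio r y y' x := by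
  rw [← weight_mul_exp r y y' x, le_mul_iff_one_le_right (weight_pos r y x), Real.one_le_exp_iff]

lemma sum_obs_prod (r : Fin K → ℕ) (f : ∀ m, X m → ℝ) :
    ∑ x : Obs X r, ∏ m, ∏ t, f m (x m t) = ∏ m, (∑ a, f m a) ^ r m := by
  classical
  have := Finset.prod_univ_sum (fun m => (Finset.univ : Finset (Fin (r m) → X m)))
    (fun m z => ∏ t, f m (z t))
  rw [Fintype.piFinset_univ] at this
  rw [← this]
  refine Finset.prod_congr rfl fun m _ => ?_
  have h := Finset.prod_univ_sum (fun _ : Fin (r m) => (Finset.univ : Finset (X m)))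
    (fun _ a => f m a)
  rw [Fintype.piFinset_univ] at h
  rw [← h]; simp

lemma sum_likelihood_mul_exp (r : Fin K → ℕ) (y y' : Fin L) (s : ℝ) :
    ∑ x : Obs X r, Q.likelihood r y x * Real.exp (s * Q.logRatio r y y' x) =
      ∏ m, Q.affinity m y y' s ^ r m := by
  simp only [affinity_eq]
  rw [← sum_obs_prod r]
  refine Finset.sum_congr rfl fun x _ => ?_
  simp only [likelihood, logRatio, Finset.mul_sum, Real.exp_sum, ← Finset.prod_mul_distrib]

lemma sum_likelihood (r : Fin K → ℕ) (y : Fin L) : ∑ x : Obs X r, Q.likelihood r y x = 1 := by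
  have := sum_likelihood_mul_exp (Q := Q) r y y 0
  simpa [affinity_eq_one (Q := Q) (y := y) (y' := y) rfl] using this

lemma chernoff_pos (y y' : Fin L) (r : Fin K → ℕ) (s : ℝ) : 0 < Q.chernoff y y' r s :=
  mul_pos (Real.exp_pos _) (Finset.prod_pos fun m _ => pow_pos (affinity_pos m y y' s) _)

lemma pairBound_eq (y y' : Fin L) (r : Fin K → ℕ) :
    Q.pairBound y y' r = ⨅ s : Icc (0 : ℝ) 1, Q.chernoff y y' r s := by
  simp only [pairBound, chernoff, logOdds]
  refine iInf_congr fun s => ?_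
  rw [Real.rpow_def_of_pos (div_pos (Q.prior_pos _) (Q.prior_pos _)), mul_comm (Real.log _)]

lemma pairBound_le (y y' : Fin L) (r : Fin K → ℕ) {s : ℝ} (hs : s ∈ Icc (0 : ℝ) 1) :
    Q.pairBound y y' r ≤ Q.chernoff y y' r s := by
  rw [pairBound_eq]
  exact ciInf_le ⟨0, by rintro _ ⟨s, rfl⟩; exact (chernoff_pos y y' r s).le⟩
    (⟨s, hs⟩ : Icc (0:ℝ) 1)

variable {Yhat : (r : Fin K → ℕ) → Obs X r → Fin L}

/-- Union bound over the wrong decision `y'`, then an exponential Markov bound: where `y'` is chosen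
its log-odds are nonnegative, so the indicator is at most `exp (s * log-odds)`. -/
lemma errorProb_le_surrogateError (hY : Q.IsMAP Yhat) (y : Fin L) (r : Fin K → ℕ) :
    Q.errorProb Yhat y r ≤ Q.surrogateError y r := by
  classical
  have h1 : Q.errorProb Yhat y r =
      ∑ y' ∈ Finset.univ.erase y, ∑ x : Obs X r,
        if Yhat r x = y' then Q.likelihood r y x else 0 := by
    rw [Finset.sum_comm, errorProb]
    refine Finset.sum_congr rfl fun x _ => ?_
    rw [Finset.sum_ite_eq]
    simp
  rw [h1]
  refine Finset.sum_le_sum fun y' _ => ?_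
  rw [pairBound_eq]
  have : Nonempty (Icc (0 : ℝ) 1) := ⟨⟨0, by simp⟩⟩
  refine le_ciInf fun s => ?_
  rw [chernoff, ← sum_likelihood_mul_exp, Finset.mul_sum]
  refine Finset.sum_le_sum fun x _ => ?_
  have hl := likelihood_pos (Q := Q) r y x
  split_ifs with hx
  · have h2 := (hY r).1 x y
    rw [hx, weight_le_iff] at h2
    rw [mul_left_comm, ← Real.exp_add, ← mul_add]
    exact le_mul_of_one_le_right hl.le (Real.one_le_exp (mul_nonneg s.2.1 h2))
  · positivity

lemma opt_le_surrogateOpt (hY : Q.IsMAP Yhat) (α : Fin L → ℝ) :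
    Q.opt Yhat α ≤ Q.surrogateOpt α :=
  biInf_mono fun r hr y => (errorProb_le_surrogateError hY y r).trans (hr y)

end

end QueryModel

/-! ### Lower bounds for the error probability. -/

namespace QueryModel

noncomputable section

variable {L K : ℕ} {X : Fin K → Type*} [∀ m, Fintype (X m)] {Q : QueryModel L K X}
  {Yhat : (r : Fin K → ℕ) → Obs X r → Fin L}

lemma IsMAP.ne_of_pos (hY : Q.IsMAP Yhat) {r : Fin K → ℕ} {y y' : Fin L} {x : Obs X r}
    (h : 0 < Q.logOdds y y' + Q.logRatio r y y' x) : Yhat r x ≠ y := by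
  intro hx
  have h1 := (hY r).1 x y'
  rw [hx, ← weight_mul_exp r y y' x] at h1
  have h2 := weight_pos (Q := Q) r y x
  have h3 := Real.one_lt_exp_iff.2 h
  nlinarith

/-- A data set with the same log-likelihood ratio of `y'` to `y` as one decided for `y'` is not
decided for `y`. -/
lemma IsMAP.ne_of_logRatio_eq (hY : Q.IsMAP Yhat) {r : Fin K → ℕ} {y y' : Fin L} (hyy : y ≠ y')
    {x x₀ : Obs X r} (hx₀ : Yhat r x₀ = y') (h : Q.logRatio r y y' x = Q.logRatio r y y' x₀) :
    Yhat r x ≠ y := by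
  intro hx
  obtain ⟨hmax, rank, hinj, hrank⟩ := hY r
  have h1 := hmax x₀ y
  rw [hx₀, weight_le_iff] at h1
  rcases h1.lt_or_eq with h2 | h2
  · exact hY.ne_of_pos (h ▸ h2) hx
  -- A tie at `x₀` is also a tie at `x`; opposite decisions would rank each label at or before the
  -- other.
  · have e0 : Q.weight r y x₀ = Q.weight r (Yhat r x₀) x₀ := by
      rw [hx₀, ← weight_mul_exp r y y' x₀, ← h2]; simp
    have e1 : Q.weight r y' x = Q.weight r (Yhat r x) x := by
      rw [hx, ← weight_mul_exp r y y' x, h, ← h2]; simp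
    have r0 := hrank x₀ y e0
    have r1 := hrank x y' e1
    rw [hx₀] at r0
    rw [hx] at r1
    exact hyy (hinj (le_antisymm r1 r0))

lemma sum_likelihood_le_errorProb {r : Fin K → ℕ} {y : Fin L} (T : Finset (Obs X r))
    (hT : ∀ x ∈ T, Yhat r x ≠ y) : ∑ x ∈ T, Q.likelihood r y x ≤ Q.errorProb Yhat y r := by
  classical
  rw [errorProb, ← Finset.sum_filter]
  exact Finset.sum_le_sum_of_subset_of_nonneg (fun x hx => by simpa using hT x hx)
    fun x _ _ => (likelihood_pos r y x).le

/-- If the tilted mean of the posterior log-odds is a suitable positive constant, the Chernoff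
objective at that tilt is a lower bound of the error probability, up to polynomial factors. -/
lemma chernoff_le_errorProb (hY : Q.IsMAP Yhat) {h D : ℝ}
    (hp : ∀ m y a, Real.exp (-h) ≤ Q.p m y a)
    (hD : D = ∑ m, (Fintype.card (X m) : ℝ) ^ 2 * h) {y y' : Fin L} {r : Fin K → ℕ} {s : ℝ}
    (hs0 : 0 ≤ s) (hs1 : s ≤ 1) (hD0 : 0 ≤ D)
    (hmean : Q.logOdds y y' + ∑ m, r m * ∑ a, Q.tilt m y y' s a * Q.llr m y y' a = D + 1) :
    Q.chernoff y y' r s * Real.exp (-(2 * D + 1)) *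
      ∏ m, (((r m : ℝ) + 1) ^ Fintype.card (X m))⁻¹ ≤ Q.errorProb Yhat y r := by
  classical
  choose T hT1 hT2 using fun m =>
    exists_typical_class (Q.tilt m y y' s) (tilt_pos m y y' s) (tilt_sum m y y' s) (r m)
  -- Centring at `D + 1` leaves log-odds between `1` and `2 * D + 1` on the typical set: positive,
  -- so an error, yet bounded, so the change of measure costs at most `exp (2 * D + 1)`.
  have hdev : ∀ x ∈ Fintype.piFinset T, |Q.logOdds y y' + Q.logRatio r y y' x - (D + 1)| ≤ D := by
    intro x hx
    rw [← hmean, hD, logRatio, add_sub_add_left_eq_sub, ← Finset.sum_sub_distrib]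
    refine (Finset.abs_sum_le_sum_abs _ _).trans (Finset.sum_le_sum fun m _ => ?_)
    exact hT2 m _ h (abs_llr_le hp m y y') (x m) (Fintype.mem_piFinset.1 hx m)
  refine le_trans ?_ (sum_likelihood_le_errorProb (Fintype.piFinset T) fun x hx =>
    hY.ne_of_pos (y' := y') (by have := (abs_le.1 (hdev x hx)).1; linarith))
  have hlik : ∀ x ∈ Fintype.piFinset T, Q.chernoff y y' r s * Real.exp (-(2 * D + 1)) *
      ∏ m, ∏ t, Q.tilt m y y' s (x m t) ≤ Q.likelihood r y x := by
    intro x hx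
    have h1 : Q.likelihood r y x = (∏ m, Q.affinity m y y' s ^ r m) *
        (∏ m, ∏ t, Q.tilt m y y' s (x m t)) * Real.exp (-(s * Q.logRatio r y y' x)) := by
      simp only [likelihood, logRatio, Finset.mul_sum, ← Finset.sum_neg_distrib, Real.exp_sum]
      rw [← Finset.prod_mul_distrib, ← Finset.prod_mul_distrib]
      refine Finset.prod_congr rfl fun m _ => ?_
      rw [Finset.prod_congr rfl fun t _ => p_eq_tilt m y y' s (x m t), Finset.prod_mul_distrib,
        Finset.prod_mul_distrib]
      simp
    have h2 : Real.exp (s * Q.logOdds y y') * Real.exp (-(2 * D + 1)) ≤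
        Real.exp (-(s * Q.logRatio r y y' x)) := by
      rw [← Real.exp_add, Real.exp_le_exp]
      have := (abs_le.1 (hdev x hx)).2
      nlinarith
    have h3 : 0 ≤ (∏ m, Q.affinity m y y' s ^ r m) * (∏ m, ∏ t, Q.tilt m y y' s (x m t)) :=
      mul_nonneg (Finset.prod_nonneg fun m _ => pow_nonneg (affinity_pos m y y' s).le _)
        (Finset.prod_nonneg fun m _ => Finset.prod_nonneg fun t _ => (tilt_pos m y y' s _).le)
    rw [h1, chernoff]
    calc _ = (∏ m, Q.affinity m y y' s ^ r m) * (∏ m, ∏ t, Q.tilt m y y' s (x m t)) *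
          (Real.exp (s * Q.logOdds y y') * Real.exp (-(2 * D + 1))) := by ring
      _ ≤ _ := mul_le_mul_of_nonneg_left h2 h3
  refine le_trans ?_ (Finset.sum_le_sum hlik)
  rw [← Finset.mul_sum]
  refine mul_le_mul_of_nonneg_left ?_ (mul_pos (chernoff_pos y y' r s) (Real.exp_pos _)).le
  have := Finset.prod_univ_sum T (fun m z => ∏ t, Q.tilt m y y' s (z t))
  rw [← this]
  exact Finset.prod_le_prod (fun m _ => by positivity) fun m _ => hT1 m

open Classical in
/-- The number of queries of the plan `r` to models that tell `y` from `y'`. -/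
def informative (Q : QueryModel L K X) (y y' : Fin L) (r : Fin K → ℕ) : ℝ :=
  ∑ m with Q.p m y ≠ Q.p m y', (r m : ℝ)

lemma informative_le (y y' : Fin L) (r : Fin K → ℕ) :
    Q.informative y y' r ≤ ∑ m, (r m : ℝ) := by
  classical
  exact Finset.sum_le_sum_of_subset_of_nonneg (Finset.filter_subset _ _) fun _ _ _ => by positivity

/-- Fix the informative responses to those of `x₀` and leave the others free. Uninformative
responses do not change the log-likelihood ratio, so all these data sets are errors for `y`; each
fixed response costs at most a factor `exp (-h)`. -/
lemma exp_neg_informative_le_errorProb (hY : Q.IsMAP Yhat) {h : ℝ}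
    (hp : ∀ m y a, Real.exp (-h) ≤ Q.p m y a) {y y' : Fin L} (hyy : y ≠ y') {r : Fin K → ℕ}
    {x₀ : Obs X r} (hx₀ : Yhat r x₀ = y') :
    Real.exp (-(h * Q.informative y y' r)) ≤ Q.errorProb Yhat y r := by
  classical
  set T : ∀ m, Finset (Fin (r m) → X m) := fun m =>
    if Q.p m y ≠ Q.p m y' then {x₀ m} else Finset.univ with hT
  refine le_trans ?_ (sum_likelihood_le_errorProb (Fintype.piFinset T) fun x hx =>
    hY.ne_of_logRatio_eq hyy hx₀ ?_)
  · have := Finset.prod_univ_sum T (fun m z => ∏ t, Q.p m y (z t))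
    simp only [likelihood]
    rw [← this, informative, Finset.mul_sum, ← Finset.sum_neg_distrib, Real.exp_sum,
      Finset.prod_filter]
    refine Finset.prod_le_prod (fun m _ => by split_ifs <;> positivity) fun m _ => ?_
    by_cases hm : Q.p m y = Q.p m y'
    · have h1 := Finset.prod_univ_sum (fun _ : Fin (r m) => (Finset.univ : Finset (X m)))
        (fun _ a => Q.p m y a)
      rw [Fintype.piFinset_univ] at h1
      simp only [hT, hm, ne_eq, not_true_eq_false, if_false]
      rw [hm] at h1
      rw [← h1]
      simp [Q.p_sum]
    · simp only [hT, hm, ne_eq, not_false_eq_true, if_true, Finset.sum_singleton]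
      calc Real.exp (-(h * r m)) = ∏ _t : Fin (r m), Real.exp (-h) := by
            rw [Finset.prod_const, ← Real.exp_nat_mul]; simp; ring
        _ ≤ _ := Finset.prod_le_prod (fun _ _ => (Real.exp_pos _).le) fun t _ => hp m y _
  · refine Finset.sum_congr rfl fun m _ => ?_
    by_cases hm : Q.p m y = Q.p m y'
    · simp [llr_eq_zero hm]
    · have := Fintype.mem_piFinset.1 hx m
      simp only [hT, hm, ne_eq, not_false_eq_true, if_true, Finset.mem_singleton] at this
      rw [this]

/-- The tilted mean can be prescribed, at a tilt bounded away from `0` and `1`, once there are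
enough informative queries. -/
lemma exists_tilt_mean_eq {h c b : ℝ} (hh : 0 < h) (hc : 0 < c)
    (hp : ∀ m y a, Real.exp (-h) ≤ Q.p m y a) {y y' : Fin L}
    (haff : ∀ m, Q.p m y ≠ Q.p m y' → Q.affinity m y y' (1 / 2) ≤ Real.exp (-c))
    {r : Fin K → ℕ} (hV : 2 * |b| < c * Q.informative y y' r) :
    ∃ s ∈ Icc (c / (4 * h)) (1 - c / (4 * h)),
      b + ∑ m, r m * ∑ a, Q.tilt m y y' s a * Q.llr m y y' a = 0 := by
  classical
  -- The desired equation says `f' s = 0`, so an interior minimizer of `f` is sought.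
  set f : ℝ → ℝ := fun s => s * b + ∑ m, r m * Real.log (Q.affinity m y y' s) with hf
  have hderiv : ∀ s, HasDerivAt f
      (1 * b + ∑ m, r m * ((Q.affinity m y y' s * ∑ a, Q.tilt m y y' s a * Q.llr m y y' a) /
        Q.affinity m y y' s)) s := fun s =>
    ((hasDerivAt_id s).mul_const b).add (HasDerivAt.fun_sum fun m _ =>
      ((hasDerivAt_affinity m y y' s).log (affinity_pos m y y' s).ne').const_mul _)
  have hsum : ∀ (s u : ℝ), (∀ m, Q.p m y ≠ Q.p m y' → u ≤ Real.log (Q.affinity m y y' s)) →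
      u * Q.informative y y' r ≤ ∑ m, r m * Real.log (Q.affinity m y y' s) := by
    intro s u hu
    rw [informative, Finset.mul_sum, Finset.sum_filter]
    refine Finset.sum_le_sum fun m _ => ?_
    split_ifs with hm
    · rw [mul_comm]; exact mul_le_mul_of_nonneg_left (hu m hm) (by positivity)
    · rw [affinity_eq_one (not_not.1 hm)]; simp
  have hhalf : ∑ m, r m * Real.log (Q.affinity m y y' (1 / 2)) ≤ -c * Q.informative y y' r := by
    rw [informative, Finset.mul_sum, Finset.sum_filter]
    refine Finset.sum_le_sum fun m _ => ?_
    split_ifs with hm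
    · rw [mul_comm]
      exact mul_le_mul_of_nonneg_right
        ((Real.log_le_iff_le_exp (affinity_pos m y y' _)).2 (haff m hm)) (by positivity)
    · rw [affinity_eq_one (not_not.1 hm)]; simp
  obtain ⟨s, hs, hmin⟩ := isCompact_Icc.exists_isMinOn (nonempty_Icc.2 (zero_le_one' ℝ))
    (fun s _ => (hderiv s).continuousAt.continuousWithinAt : ContinuousOn f (Icc 0 1))
  have hms : f s ≤ f (1 / 2) := hmin ⟨by norm_num, by norm_num⟩
  simp only [hf] at hms
  have hsb : -|b| ≤ s * b := by
    have := abs_le.1 (le_refl |b|)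
    rcases le_or_gt 0 b with hb | hb
    · have := abs_nonneg b; nlinarith [mul_nonneg hs.1 hb]
    · rw [abs_of_neg hb]; nlinarith [hs.2]
  have hb := le_abs_self b
  -- Within `c / (4 * h)` of an end point, `f ≥ -|b| - (c / 4) * V`, with `V` the informative count,
  -- while `f (1 / 2) ≤ |b| / 2 - c * V`. A minimizer there would give `c * V ≤ 2 * |b|`.
  have hδ : c / (4 * h) * h = c / 4 := by field_simp
  have hδ0 : 0 < c / (4 * h) := by positivity
  have hs' : s ∈ Icc (c / (4 * h)) (1 - c / (4 * h)) := by
    constructor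
    · by_contra! hlt
      have := hsum s (-(c / 4)) fun m _ => by
        rw [Real.le_log_iff_exp_le (affinity_pos m y y' s)]
        refine le_trans (Real.exp_le_exp.2 ?_) (exp_neg_mul_le_affinity hp m y y' hs.1)
        nlinarith
      linarith
    · by_contra! hlt
      have := hsum s (-(c / 4)) fun m _ => by
        rw [Real.le_log_iff_exp_le (affinity_pos m y y' s)]
        refine le_trans (Real.exp_le_exp.2 ?_) (exp_neg_mul_one_sub_le_affinity hp m y y' hs.2)
        nlinarith
      linarith
  refine ⟨s, hs', ?_⟩
  have hloc : IsLocalMin f s := hmin.isLocalMin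
    (Icc_mem_nhds (by linarith [hs'.1]) (by linarith [hs'.2]))
  have h0 := hloc.hasDerivAt_eq_zero (hderiv s)
  rw [← h0, one_mul]
  congr 1
  refine Finset.sum_congr rfl fun m _ => ?_
  rw [mul_div_cancel_left₀ _ (affinity_pos m y y' s).ne']

/-! ### The gain from extra queries. -/

lemma chernoff_add (y y' : Fin L) (r : Fin K → ℕ) (t : ℕ) (s : ℝ) :
    Q.chernoff y y' (fun m => r m + t) s =
      Q.chernoff y y' r s * (∏ m, Q.affinity m y y' s) ^ t := by
  simp only [chernoff, pow_add, Finset.prod_mul_distrib, Finset.prod_pow]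
  ring

lemma prod_affinity_lt_one (hdist : Q.Distinguishable) {y y' : Fin L} (hyy : y ≠ y') {s : ℝ}
    (hs0 : 0 < s) (hs1 : s < 1) : ∏ m, Q.affinity m y y' s < 1 := by
  obtain ⟨m, hm⟩ := hdist y y' hyy
  rw [← Finset.mul_prod_erase _ _ (Finset.mem_univ m)]
  exact mul_lt_one_of_nonneg_of_lt_one_left (affinity_pos m y y' s).le
    (affinity_lt_one hm hs0 hs1)
    (Finset.prod_le_one (fun m _ => (affinity_pos m y y' s).le)
      fun m _ => affinity_le_one m y y' hs0.le hs1.le)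

/-- By compactness, one query to every model gains a factor uniform over tilts away from `0` and
`1`; the tilt used later varies with the plan. -/
lemma exists_prod_affinity_le (hdist : Q.Distinguishable) {y y' : Fin L} (hyy : y ≠ y') {δ : ℝ}
    (hδ : 0 < δ) (hδ' : δ ≤ 1 / 2) :
    ∃ γ > 0, ∀ s ∈ Icc δ (1 - δ), ∏ m, Q.affinity m y y' s ≤ Real.exp (-γ) := by
  obtain ⟨s, hs, hmax⟩ := isCompact_Icc.exists_isMaxOn
    (nonempty_Icc.2 (by linarith : δ ≤ 1 - δ))
    (continuous_finsetProd _ fun m _ => continuous_affinity (Q := Q) m y y').continuousOn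
  have h0 : 0 < ∏ m, Q.affinity m y y' s := Finset.prod_pos fun m _ => affinity_pos m y y' s
  refine ⟨-Real.log (∏ m, Q.affinity m y y' s), ?_, fun u hu => ?_⟩
  · exact neg_pos.2 (Real.log_neg h0 (prod_affinity_lt_one hdist hyy (by linarith [hs.1])
      (by linarith [hs.2])))
  · rw [neg_neg, Real.exp_log h0]
    exact hmax hu

lemma exists_affinity_half_le (hdist : Q.Distinguishable) {h : ℝ}
    (hp : ∀ m y a, Real.exp (-h) ≤ Q.p m y a) {y y' : Fin L} (hyy : y ≠ y') :
    ∃ c > 0, c ≤ h ∧ ∀ m, Q.p m y ≠ Q.p m y' → Q.affinity m y y' (1 / 2) ≤ Real.exp (-c) := by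
  classical
  obtain ⟨m₀, hm₀⟩ := hdist y y' hyy
  obtain ⟨m, hm, hmax⟩ := Finset.exists_max_image
    (Finset.univ.filter fun m => Q.p m y ≠ Q.p m y') (fun m => Q.affinity m y y' (1 / 2))
    ⟨m₀, by simpa using hm₀⟩
  have h0 := affinity_pos (Q := Q) m y y' (1 / 2)
  have hlt := Real.log_neg h0 (affinity_lt_one (Finset.mem_filter.1 hm).2 (by norm_num)
    (by norm_num))
  refine ⟨-Real.log (Q.affinity m y y' (1 / 2)), neg_pos.2 hlt, ?_, fun u hu => ?_⟩
  · have := (Real.le_log_iff_exp_le h0).2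
      (exp_neg_mul_le_affinity hp m y y' (by norm_num : (0:ℝ) ≤ 1 / 2))
    linarith
  · rw [neg_neg, Real.exp_log h0]
    exact hmax u (by simpa using hu)

lemma chernoff_half_le (y y' : Fin L) (r : Fin K → ℕ) :
    Q.chernoff y y' r (1 / 2) ≤ Real.exp |Q.logOdds y y'| := by
  rw [chernoff, ← mul_one (Real.exp |_|)]
  refine mul_le_mul (Real.exp_le_exp.2 ?_) (Finset.prod_le_one
    (fun m _ => pow_nonneg (affinity_pos m y y' _).le _) fun m _ =>
      pow_le_one₀ (affinity_pos m y y' _).le (affinity_le_one m y y' (by norm_num) (by norm_num)))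
    (Finset.prod_nonneg fun m _ => pow_nonneg (affinity_pos m y y' _).le _) (Real.exp_pos _).le
  have := le_abs_self (Q.logOdds y y')
  have := abs_nonneg (Q.logOdds y y')
  linarith

lemma exp_neg_log_le_prod_inv (r : Fin K → ℕ) (d : Fin K → ℕ) :
    Real.exp (-((∑ m, (d m : ℝ)) * Real.log ((∑ m, (r m : ℝ)) + 1))) ≤
      ∏ m, (((r m : ℝ) + 1) ^ d m)⁻¹ := by
  rw [Finset.sum_mul, ← Finset.sum_neg_distrib, Real.exp_sum]
  refine Finset.prod_le_prod (fun m _ => (Real.exp_pos _).le) fun m _ => ?_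
  have h0 : (0 : ℝ) < r m + 1 := by positivity
  rw [Real.exp_neg]
  refine inv_anti₀ (by positivity) ?_
  rw [← Real.exp_log h0, ← Real.exp_nat_mul, Real.exp_le_exp]
  refine mul_le_mul_of_nonneg_left (Real.log_le_log h0 ?_) (by positivity)
  have := Finset.single_le_sum (f := fun m => (r m : ℝ)) (fun m _ => by positivity)
    (Finset.mem_univ m)
  linarith

/-- Logarithmically many extra queries to every model bring the pairwise Chernoff bound below the
error probability of the original plan. -/
lemma exists_pairBound_add_le (hL : 0 < L) (hdist : Q.Distinguishable) {y y' : Fin L}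
    (hyy : y ≠ y') : ∃ a : ℝ, 0 ≤ a ∧
      ∀ Yhat : (r : Fin K → ℕ) → Obs X r → Fin L, Q.IsMAP Yhat → ∀ r : Fin K → ℕ,
      (∃ x, Yhat r x = y') → ∀ t : ℕ, a * (1 + Real.log ((∑ m, (r m : ℝ)) + 1)) ≤ t →
        Q.pairBound y y' (fun m => r m + t) ≤ Q.errorProb Yhat y r / L := by
  obtain ⟨h, hh, hp⟩ := Q.exists_exp_neg_le
  obtain ⟨c, hc, hch, haff⟩ := exists_affinity_half_le hdist hp hyy
  have hh0 : 0 < h := by linarith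
  have hδ : c / (4 * h) ≤ 1 / 4 := by
    rw [div_le_div_iff₀ (by positivity) (by norm_num)]; linarith
  have hδ0 : 0 < c / (4 * h) := by positivity
  obtain ⟨γ, hγ, hprod⟩ := exists_prod_affinity_le hdist hyy hδ0 (by linarith)
  obtain ⟨D, hD⟩ : ∃ D : ℝ, D = ∑ m, (Fintype.card (X m) : ℝ) ^ 2 * h := ⟨_, rfl⟩
  have hD0 : 0 ≤ D := hD ▸ Finset.sum_nonneg fun m _ => by positivity
  set b := Q.logOdds y y' with hb
  set d : ℝ := ∑ m, (Fintype.card (X m) : ℝ) with hd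
  have hd0 : 0 ≤ d := Finset.sum_nonneg fun m _ => by positivity
  set V := 2 * |b - (D + 1)| / c with hV
  have hV0 : 0 ≤ V := by positivity
  have hL0 : (0 : ℝ) < L := by exact_mod_cast hL
  have hlogL : 0 ≤ Real.log L := Real.log_natCast_nonneg L
  have hL' : (L : ℝ)⁻¹ = Real.exp (-Real.log L) := by rw [Real.exp_neg, Real.exp_log hL0]
  -- One constant for both cases: change of measure, division by `L`, polynomial mass, few
  -- informative queries, prior odds.
  set e := 2 * D + 1 + Real.log L + d + h * V + |b| with he
  refine ⟨e / γ, by positivity, fun Yhat hY r ⟨x₀, hx₀⟩ t ht => ?_⟩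
  have hlog : 0 ≤ Real.log ((∑ m, (r m : ℝ)) + 1) :=
    Real.log_nonneg (by have : 0 ≤ ∑ m, (r m : ℝ) := by positivity
                        linarith)
  set l := Real.log ((∑ m, (r m : ℝ)) + 1) with hl
  have ht' : e * (1 + l) ≤ γ * t := by
    rw [div_mul_eq_mul_div, div_le_iff₀ hγ] at ht; linarith
  have hbound : ∀ s ∈ Icc (c / (4 * h)) (1 - c / (4 * h)),
      Q.pairBound y y' (fun m => r m + t) ≤ Q.chernoff y y' r s * Real.exp (-(γ * t)) := by
    intro s hs
    refine (pairBound_le y y' _ ⟨hδ0.le.trans hs.1, by linarith [hs.2]⟩).trans ?_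
    rw [chernoff_add]
    refine mul_le_mul_of_nonneg_left ?_ (chernoff_pos y y' r s).le
    refine (pow_le_pow_left₀ (Finset.prod_nonneg fun m _ => (affinity_pos m y y' s).le)
      (hprod s hs) t).trans_eq ?_
    rw [← Real.exp_nat_mul]; congr 1; ring
  have hdl : 0 ≤ d * l := mul_nonneg hd0 hlog
  have hhV : 0 ≤ h * V := by positivity
  have hb0 := abs_nonneg b
  have hel : e * (1 + l) = e + d * l + (e - d) * l := by ring
  have hel' : 0 ≤ (e - d) * l := mul_nonneg (by linarith) hlog
  rw [div_eq_mul_inv, hL']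
  -- The shift by `D + 1` turns a zero of the tilted mean into the mean required by
  -- `chernoff_le_errorProb`.
  by_cases hcase : 2 * |b - (D + 1)| < c * Q.informative y y' r
  · obtain ⟨s, hs, hmean⟩ := exists_tilt_mean_eq hh0 hc hp haff hcase
    have hlow := chernoff_le_errorProb hY hp hD (hδ0.le.trans hs.1)
      (by linarith [hs.2]) hD0 (r := r) (by rw [← hb]; linarith)
    refine (hbound s hs).trans ?_
    have hpoly := exp_neg_log_le_prod_inv r (fun m => Fintype.card (X m))
    rw [← hd, ← hl] at hpoly
    calc Q.chernoff y y' r s * Real.exp (-(γ * t))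
        ≤ Q.chernoff y y' r s *
            (Real.exp (-(2 * D + 1)) * Real.exp (-(d * l)) * Real.exp (-Real.log L)) := by
          refine mul_le_mul_of_nonneg_left ?_ (chernoff_pos y y' r s).le
          rw [← Real.exp_add, ← Real.exp_add, Real.exp_le_exp]
          linarith
      _ = Q.chernoff y y' r s * Real.exp (-(2 * D + 1)) * Real.exp (-(d * l)) *
            Real.exp (-Real.log L) := by ring
      _ ≤ _ := by
          refine mul_le_mul_of_nonneg_right (le_trans ?_ hlow) (Real.exp_pos _).le
          exact mul_le_mul_of_nonneg_left hpoly
            (mul_pos (chernoff_pos y y' r s) (Real.exp_pos _)).le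
  · have hV' : Q.informative y y' r ≤ V := by
      rw [hV, le_div_iff₀ hc]; linarith
    have hlow := exp_neg_informative_le_errorProb hY hp hyy hx₀
    refine (hbound (1 / 2) ⟨by linarith, by linarith⟩).trans ?_
    calc Q.chernoff y y' r (1 / 2) * Real.exp (-(γ * t))
        ≤ Real.exp |b| * Real.exp (-(γ * t)) :=
          mul_le_mul_of_nonneg_right (chernoff_half_le y y' r) (Real.exp_pos _).le
      _ ≤ Real.exp (-(h * V)) * Real.exp (-Real.log L) := by
          rw [← Real.exp_add, ← Real.exp_add, Real.exp_le_exp]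
          linarith
      _ ≤ _ := by
          refine mul_le_mul_of_nonneg_right (le_trans (Real.exp_le_exp.2 ?_) hlow)
            (Real.exp_pos _).le
          exact neg_le_neg (mul_le_mul_of_nonneg_left hV' hh0.le)

end

end QueryModel

/-! ### From pairwise bounds to plans and costs. -/

namespace QueryModel

noncomputable section

variable {L K : ℕ} {X : Fin K → Type*} [∀ m, Fintype (X m)] {Q : QueryModel L K X}
  {Yhat : (r : Fin K → ℕ) → Obs X r → Fin L}

/-- A label that is never chosen has error probability `1`. This supplies the data set `x₀` for the
case of few informative queries. -/
lemma exists_decision_eq {α : Fin L → ℝ} (hα : ∀ y, α y < 1) {r : Fin K → ℕ}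
    (hr : r ∈ Q.feasible Yhat α) (y : Fin L) : ∃ x, Yhat r x = y := by
  by_contra! hne
  have h1 := hr y
  have h2 : Q.errorProb Yhat y r = 1 := by
    rw [errorProb, ← sum_likelihood (Q := Q) r y]
    exact Finset.sum_congr rfl fun x _ => if_pos (hne x)
  linarith [hα y]

/-- Logarithmically many extra queries to every model make a feasible plan surrogate-feasible. -/
lemma exists_add_mem_surrogateFeasible (hL : 0 < L) (hdist : Q.Distinguishable) :
    ∃ a : ℝ, 0 ≤ a ∧ ∀ Yhat : (r : Fin K → ℕ) → Obs X r → Fin L, Q.IsMAP Yhat →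
      ∀ α : Fin L → ℝ, (∀ y, α y ∈ Ioo (0 : ℝ) 1) → ∀ r ∈ Q.feasible Yhat α,
      ∀ t : ℕ, a * (1 + Real.log ((∑ m, (r m : ℝ)) + 1)) ≤ t →
        (fun m => r m + t) ∈ Q.surrogateFeasible α := by
  choose a ha0 ha using fun (y y' : Fin L) (h : y ≠ y') =>
    exists_pairBound_add_le (Q := Q) hL hdist h
  set A : Fin L → Fin L → ℝ := fun y y' => if h : y ≠ y' then a y y' h else 0 with hA
  have hA0 : ∀ y y', 0 ≤ A y y' := fun y y' => by
    simp only [hA]; split_ifs with h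
    · exact ha0 y y' h
    · exact le_rfl
  refine ⟨∑ y, ∑ y', A y y', Finset.sum_nonneg fun y _ => Finset.sum_nonneg fun y' _ => hA0 y y',
    fun Yhat hY α hα r hr t ht y => ?_⟩
  have hlog : 0 ≤ Real.log ((∑ m, (r m : ℝ)) + 1) :=
    Real.log_nonneg (by have : 0 ≤ ∑ m, (r m : ℝ) := by positivity
                        linarith)
  have hP : 0 ≤ Q.errorProb Yhat y r := Finset.sum_nonneg fun x _ => by
    split_ifs
    · exact (likelihood_pos r y x).le
    · exact le_rfl
  have hL0 : (0 : ℝ) < L := by exact_mod_cast hL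
  calc Q.surrogateError y (fun m => r m + t)
      ≤ ∑ _y' ∈ Finset.univ.erase y, Q.errorProb Yhat y r / L := by
        refine Finset.sum_le_sum fun y' hy' => ?_
        have hyy : y ≠ y' := (Finset.ne_of_mem_erase hy').symm
        refine ha y y' hyy Yhat hY r (exists_decision_eq (fun y => (hα y).2) hr y') t
          (le_trans (mul_le_mul_of_nonneg_right ?_ (by linarith)) ht)
        have h1 : a y y' hyy = A y y' := by simp [hA, hyy]
        rw [h1]
        exact (Finset.single_le_sum (f := fun y' => A y y') (fun y' _ => hA0 y y')
          (Finset.mem_univ y')).trans (Finset.single_le_sum (f := fun y => ∑ y', A y y')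
            (fun y _ => Finset.sum_nonneg fun y' _ => hA0 y y') (Finset.mem_univ y))
    _ ≤ ∑ _y' : Fin L, Q.errorProb Yhat y r / L :=
        Finset.sum_le_sum_of_subset_of_nonneg (Finset.subset_univ _) fun _ _ _ => by positivity
    _ = Q.errorProb Yhat y r := by simp; field_simp
    _ ≤ α y := hr y

/-- A feasible plan has at least logarithmically many queries. -/
lemma log_le_of_mem_feasible (hL : 2 ≤ L) (hY : Q.IsMAP Yhat) {h : ℝ} (hh : 0 ≤ h)
    (hp : ∀ m y a, Real.exp (-h) ≤ Q.p m y a) {α : Fin L → ℝ}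
    (hα : ∀ y, α y ∈ Ioo (0 : ℝ) 1) {r : Fin K → ℕ} (hr : r ∈ Q.feasible Yhat α) :
    Real.log (1 / tolMin α) ≤ h * ∑ m, (r m : ℝ) := by
  have : Nonempty (Fin L) := ⟨⟨0, by omega⟩⟩
  have : Nontrivial (Fin L) := Fin.nontrivial_iff_two_le.2 hL
  obtain ⟨y, hy⟩ : ∃ y, α y = tolMin α := exists_eq_ciInf_of_finite
  obtain ⟨y', hyy⟩ := exists_ne y
  obtain ⟨x, hx⟩ := exists_decision_eq (fun y => (hα y).2) hr y'
  have h1 := (exp_neg_informative_le_errorProb hY hp hyy.symm hx).trans (hr y)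
  rw [hy] at h1
  have hpos : 0 < tolMin α := hy ▸ (hα y).1
  have h2 := (Real.le_log_iff_exp_le hpos).2 h1
  rw [one_div, Real.log_inv]
  have := mul_le_mul_of_nonneg_left (informative_le (Q := Q) y y' r) hh
  linarith

lemma planCost_add (r : Fin K → ℕ) (t : ℕ) :
    Q.planCost (fun m => r m + t) = Q.planCost r + t * ∑ m, Q.cost m := by
  simp only [planCost]
  rw [Finset.mul_sum, ← Finset.sum_add_distrib]
  refine Finset.sum_congr rfl fun m _ => ?_
  push_cast; ring

lemma exists_pos_le_cost (Q : QueryModel L K X) : ∃ c > 0, ∀ m, c ≤ Q.cost m := by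
  rcases isEmpty_or_nonempty (Fin K) with hK | hK
  · exact ⟨1, one_pos, fun m => hK.elim m⟩
  · obtain ⟨m, hm⟩ := Finite.exists_min Q.cost
    exact ⟨Q.cost m, Q.cost_pos m, hm⟩

lemma mul_sum_le_planCost {c : ℝ} (hc : ∀ m, c ≤ Q.cost m) (r : Fin K → ℕ) :
    c * ∑ m, (r m : ℝ) ≤ Q.planCost r := by
  rw [planCost, Finset.mul_sum]
  exact Finset.sum_le_sum fun m _ => mul_le_mul_of_nonneg_right (hc m) (by positivity)

/-- With `u = h * n / M ≥ 1`, `log (n + 1) ≤ log M + u`; since `log M ≥ 1`, each of `1`, `log M` and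
`u` is at most `u * log M`. -/
lemma one_add_log_le {h M n : ℝ} (hh : 1 ≤ h) (hM : Real.exp 1 ≤ M) (hn : M ≤ h * n) :
    1 + Real.log (n + 1) ≤ 4 * h * (Real.log M / M) * n := by
  have hM0 : 0 < M := (Real.exp_pos 1).trans_le hM
  have hlM : 1 ≤ Real.log M := (Real.le_log_iff_exp_le hM0).2 hM
  have hM1 : 1 ≤ M := by linarith [Real.add_one_le_exp 1]
  have hn0 : 0 < n := by
    by_contra! hle
    nlinarith
  set u := h * n / M with hu
  have hu1 : 1 ≤ u := by rw [hu, one_le_div hM0]; exact hn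
  have h1 : n + 1 ≤ M * (u + 1) := by
    have : M * u = h * n := by rw [hu]; field_simp
    nlinarith
  have h2 : Real.log (n + 1) ≤ Real.log M + u := by
    refine (Real.log_le_log (by linarith) h1).trans ?_
    rw [Real.log_mul hM0.ne' (by linarith)]
    have := Real.log_le_sub_one_of_pos (by linarith : 0 < u + 1)
    linarith
  have h3 : 4 * h * (Real.log M / M) * n = 4 * (Real.log M * u) := by rw [hu]; field_simp
  rw [h3]
  nlinarith

/-- The bounds on the ratio of the two optima, with uniform constants. -/
lemma exists_ratio_bound (hL : 2 ≤ L) (hdist : Q.Distinguishable) :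
    ∃ C : ℝ, 0 < C ∧ ∃ ε : ℝ, 0 < ε ∧ ε < 1 ∧
      ∀ Yhat : (r : Fin K → ℕ) → Obs X r → Fin L, Q.IsMAP Yhat →
      ∀ α : Fin L → ℝ, (∀ y, α y ∈ Ioo (0 : ℝ) 1) → tolMin α < ε → Q.opt Yhat α < ∞ →
        1 ≤ Q.surrogateOpt α / Q.opt Yhat α ∧
        Q.surrogateOpt α / Q.opt Yhat α ≤
          ENNReal.ofReal (1 + C * (Real.log (Real.log (1 / tolMin α)) /
            Real.log (1 / tolMin α))) := by
  obtain ⟨h, hh, hp⟩ := Q.exists_exp_neg_le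
  obtain ⟨a, ha0, ha⟩ := exists_add_mem_surrogateFeasible (by omega) hdist
  obtain ⟨c, hc0, hc⟩ := Q.exists_pos_le_cost
  set S := ∑ m, Q.cost m with hS
  have hS0 : 0 ≤ S := Finset.sum_nonneg fun m _ => (Q.cost_pos m).le
  -- This `ε` ensures `log (1 / tolMin α) ≥ e`, so the iterated logarithm is at least `1`; the
  -- summand `+ 1` makes the constant positive from `0 ≤ S` alone.
  refine ⟨4 * h * (a + 1) * S / c + 1, by positivity, Real.exp (-Real.exp 1), Real.exp_pos _,
    Real.exp_lt_one_iff.2 (by have := Real.exp_pos 1; linarith), fun Yhat hY α hα htol hopt => ?_⟩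
  have : Nonempty (Fin L) := ⟨⟨0, by omega⟩⟩
  obtain ⟨y₀, hy₀⟩ : ∃ y, α y = tolMin α := exists_eq_ciInf_of_finite
  have hpos : 0 < tolMin α := hy₀ ▸ (hα y₀).1
  set M := Real.log (1 / tolMin α) with hMdef
  have hM : Real.exp 1 ≤ M := by
    have := (Real.log_lt_iff_lt_exp hpos).2 htol
    rw [hMdef, one_div, Real.log_inv]; linarith
  have hM0 : 0 < M := (Real.exp_pos 1).trans_le hM
  have hlM : 1 ≤ Real.log M := (Real.le_log_iff_exp_le hM0).2 hM
  have hn : ∀ r ∈ Q.feasible Yhat α, M ≤ h * ∑ m, (r m : ℝ) := fun r hr =>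
    log_le_of_mem_feasible hL hY (by linarith) hp hα hr
  have hcost : ∀ r ∈ Q.feasible Yhat α, c * (M / h) ≤ Q.planCost r := fun r hr =>
    (mul_le_mul_of_nonneg_left (by rw [div_le_iff₀ (by linarith), mul_comm]; exact hn r hr)
      hc0.le).trans (mul_sum_le_planCost hc r)
  have hopt0 : Q.opt Yhat α ≠ 0 := by
    have h1 : ENNReal.ofReal (c * (M / h)) ≤ Q.opt Yhat α :=
      le_iInf₂ fun r hr => ENNReal.ofReal_le_ofReal (hcost r hr)
    have h2 : 0 < ENNReal.ofReal (c * (M / h)) := ENNReal.ofReal_pos.2 (by positivity)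
    exact (h2.trans_le h1).ne'
  refine ⟨?_, ?_⟩
  · rw [ENNReal.le_div_iff_mul_le (Or.inl hopt0) (Or.inl hopt.ne), one_mul]
    exact opt_le_surrogateOpt hY α
  · set ρ := 1 + (4 * h * (a + 1) * S / c + 1) * (Real.log M / M) with hρ
    have hρ0 : 0 < ρ := by positivity
    have hρ' : 0 < ENNReal.ofReal ρ := ENNReal.ofReal_pos.2 hρ0
    -- Moving the factor `ρ` to the other side leaves `opt` alone on the right, so the infimum can
    -- be checked plan by plan.
    rw [ENNReal.div_le_iff hopt0 hopt.ne, mul_comm,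
      ← ENNReal.div_le_iff hρ'.ne' ENNReal.ofReal_ne_top]
    refine le_iInf₂ fun r hr => ?_
    rw [ENNReal.div_le_iff hρ'.ne' ENNReal.ofReal_ne_top, mul_comm, ← ENNReal.ofReal_mul hρ0.le]
    set n := ∑ m, (r m : ℝ) with hndef
    have hn0 : 0 ≤ n := Finset.sum_nonneg fun m _ => by positivity
    have hl0 : 0 ≤ Real.log (n + 1) := Real.log_nonneg (by linarith)
    set t := ⌈a * (1 + Real.log (n + 1))⌉₊ with ht
    have hmem := ha Yhat hY α hα r hr t (Nat.le_ceil _)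
    refine (iInf₂_le _ hmem).trans (ENNReal.ofReal_le_ofReal ?_)
    rw [planCost_add, ← hS]
    -- The ceiling costs at most `1`, absorbed by replacing `a` with `a + 1`.
    have ht1 : (t : ℝ) ≤ (a + 1) * (1 + Real.log (n + 1)) := by
      have := (Nat.ceil_lt_add_one (mul_nonneg ha0 (by linarith : 0 ≤ 1 + Real.log (n + 1)))).le
      linarith
    have hcn := mul_sum_le_planCost hc r
    rw [← hndef] at hcn
    have hfrac : 0 ≤ Real.log M / M := by positivity
    have hC0 : 0 ≤ Q.planCost r := (mul_nonneg hc0.le hn0).trans hcn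
    calc Q.planCost r + t * S
        ≤ Q.planCost r + (a + 1) * (4 * h * (Real.log M / M) * n) * S := by
          have := one_add_log_le hh hM (hn r hr)
          gcongr
          exact ht1.trans (by gcongr)
      _ = Q.planCost r + 4 * h * (a + 1) * S / c * (Real.log M / M) * (c * n) := by
          field_simp
      _ ≤ Q.planCost r + 4 * h * (a + 1) * S / c * (Real.log M / M) * Q.planCost r := by
          gcongr
      _ ≤ ρ * Q.planCost r := by
          rw [hρ]
          nlinarith [mul_nonneg hfrac hC0]

end

end QueryModel

/-! ### The limit of the ratio. -/

lemma tendsto_log_log_inv_div_log_inv :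
    Tendsto (fun x : ℝ => Real.log (Real.log (1 / x)) / Real.log (1 / x)) (𝓝[>] 0) (𝓝 0) := by
  have h1 : Tendsto (fun M : ℝ => Real.log M / M) atTop (𝓝 0) :=
    Real.isLittleO_log_id_atTop.tendsto_div_nhds_zero
  have h2 : Tendsto (fun x : ℝ => Real.log (1 / x)) (𝓝[>] 0) atTop := by
    simp only [one_div]
    exact Real.tendsto_log_atTop.comp tendsto_inv_nhdsGT_zero
  exact h1.comp h2

theorem theorem1 {L K : ℕ} (hL : 2 ≤ L) {X : Fin K → Type*} [∀ m, Fintype (X m)]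
    (Q : QueryModel L K X) (hdist : Q.Distinguishable) (B : ℝ) (hB : Q.BoundedLLR B) :
    (∃ C : ℝ, 0 < C ∧ ∃ ε : ℝ, 0 < ε ∧ ε < 1 ∧
      ∀ Yhat : (r : Fin K → ℕ) → QueryModel.Obs X r → Fin L, Q.IsMAP Yhat →
      ∀ α : Fin L → ℝ, (∀ y, α y ∈ Ioo (0 : ℝ) 1) → QueryModel.tolMin α < ε →
        Q.opt Yhat α < ∞ →
          1 ≤ Q.surrogateOpt α / Q.opt Yhat α ∧
          Q.surrogateOpt α / Q.opt Yhat α ≤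
            ENNReal.ofReal (1 + C * (Real.log (Real.log (1 / QueryModel.tolMin α)) /
              Real.log (1 / QueryModel.tolMin α)))) ∧
    (∀ Yhat : (r : Fin K → ℕ) → QueryModel.Obs X r → Fin L, Q.IsMAP Yhat →
      Tendsto (fun α : Fin L → ℝ => Q.surrogateOpt α / Q.opt Yhat α)
        (comap QueryModel.tolMin (𝓝[>] 0) ⊓
          𝓟 {α | (∀ y, α y ∈ Ioo (0 : ℝ) 1) ∧ Q.opt Yhat α < ∞})
        (𝓝 1)) := by
  obtain ⟨C, hC, ε, hε, hε1, hbound⟩ := QueryModel.exists_ratio_bound hL hdist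
  refine ⟨⟨C, hC, ε, hε, hε1, hbound⟩, fun Yhat hY => ?_⟩
  have hlim : Tendsto (fun x : ℝ => ENNReal.ofReal
      (1 + C * (Real.log (Real.log (1 / x)) / Real.log (1 / x)))) (𝓝[>] 0) (𝓝 1) := by
    have h := ENNReal.tendsto_ofReal
      ((tendsto_log_log_inv_div_log_inv.const_mul C).const_add 1)
    simpa using h
  have hev : ∀ᶠ α in comap QueryModel.tolMin (𝓝[>] 0) ⊓
      𝓟 {α : Fin L → ℝ | (∀ y, α y ∈ Ioo (0 : ℝ) 1) ∧ Q.opt Yhat α < ∞},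
      ((∀ y, α y ∈ Ioo (0 : ℝ) 1) ∧ Q.opt Yhat α < ∞) ∧ QueryModel.tolMin α < ε :=
    (eventually_inf_principal.2 (Eventually.of_forall fun _ h => h)).and
      ((tendsto_comap.eventually (nhdsWithin_le_nhds (Iio_mem_nhds hε))).filter_mono inf_le_left)
  refine tendsto_of_tendsto_of_tendsto_of_le_of_le' tendsto_const_nhds
    (hlim.comp (tendsto_comap.mono_left inf_le_left)) ?_ ?_
  · filter_upwards [hev] with α hα using (hbound Yhat hY α hα.1.1 hα.2 hα.1.2).1
  · filter_upwards [hev] with α hα using (hbound Yhat hY α hα.1.1 hα.2 hα.1.2).2
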